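/- All graphs are finite and simple. A class of graphs is a collection of graphs closed under isomorphism. A graph $H$ is a minor of a graph $G$ if a graph isomorphic to $H$ can be obtained from a subgraph of $G$ by contracting edges; a class is closed under subdivision if it contains every graph obtained from one of its members by replacing each edge $e$ by a path with some number $k_e\ge 0$ of internal vertices. A weighted graph is a graph together with an edge weighting with values in $\mathbb{R}^+\cup\{\infty\}$, where $\mathbb{R}^+=(0,\infty)$; an unweighted graph is regarded as a weighted graph with all weights $1$. The distance $\operatorname{dist}_G(u,v)$ is the least total weight of a path from $u$ to $v$ ($\infty$ if there is none). For an integer $n\ge 0$, a function $f:\mathbb{R}^+\to\mathbb{R}^+$ is an $n$-dimensional control function for a class $\mathcal{W}$ of weighted graphs if for every $G\in\mathcal{W}$ and every real $r>0$ there is a colouring of $V(G)$ with $n+1$ colours such that, whenever $u,v$ are joined by a sequence of vertices of one colour in which consecutive vertices are at distance at most $r$ in $G$, we have $\operatorname{dist}_G(u,v)\le f(r)$. The asymptotic dimension $\operatorname{asdim}(\mathcal{W})$ is the least $n\ge 0$ for which $\mathcal{W}$ has an $n$-dimensional control function, and the Assouad–Nagata dimension $\operatorname{ANdim}(\mathcal{W})$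 is the least $n\ge 0$ for which $\mathcal{W}$ has an $n$-dimensional control function $f$ such that, for some $c>0$, $f(r)\le cr$ for all $r>0$; each is $\infty$ if there is no such $n$. For a class $\mathcal{G}$ of graphs and $S\subseteq\mathbb{R}^+$, let $\mathcal{G}_S$ be the class of all weighted graphs whose edge weights all lie in $S$ and whose underlying unweighted graph is in $\mathcal{G}$. Let $\mathbb{N}=\{1,2,\dots\}$. **Theorem.** Let $\mathcal{G}$ be a class of graphs such that every graph is a minor of some graph in $\mathcal{G}$. Then (a) $\operatorname{asdim}(\mathcal{G}_{\mathbb{R}^+})=\infty$; (b) $\operatorname{ANdim}(\mathcal{G}_{\mathbb{N}})=\infty$; and (c) if $\mathcal{G}$ is closed under subdivision, then $\operatorname{ANdim}(\mathcal{G})=\infty$. -/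

import Mathlib

open scoped ENNReal

/-- The set `ℝ⁺` of strictly positive reals, as a type. -/
abbrev PosReal : Type := {x : ℝ // 0 < x}

/-- A finite simple graph. As classes of graphs are closed under isomorphism and graphs are finite,
vertex sets in `Type` represent all finite graphs. -/
structure FinGraph where
  V : Type
  finite : Finite V
  graph : SimpleGraph V

/-- A finite graph equipped with a weighting `E(G) → ℝ⁺ ∪ {∞}`;
the underlying unweighted graph is `G.toFinGraph`. -/
structure WeightedGraph extends FinGraph where
  weight : graph.edgeSet → ℝ≥0∞
  weight_pos : ∀ e, 0 < weight e

/-- A class of (finite) graphs: a collection of graphs that is closed under isomorphism. -/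
structure GraphClass where
  carrier : Set FinGraph
  iso_closed : ∀ G H : FinGraph, Nonempty (G.graph ≃g H.graph) → G ∈ carrier → H ∈ carrier

namespace FinGraph

/-- A subgraph of `G`, as a graph in its own right. -/
abbrev ofSubgraph (G : FinGraph) (S : G.graph.Subgraph) : FinGraph where
  V := S.verts
  finite := by
    have := G.finite
    infer_instance
  graph := S.coe

/-- `K` is (isomorphic to) the simple graph obtained from `G` by contracting one edge `uv`:
the quotient map `φ` identifies `u` with `v` and no other two vertices. -/
def IsEdgeContraction (G K : FinGraph) : Prop :=
  ∃ u v : G.V, G.graph.Adj u v ∧ ∃ φ : G.V → K.V, Function.Surjective φ ∧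
    (∀ a b, φ a = φ b ↔ a = b ∨ s(a, b) = s(u, v)) ∧
    ∀ x y, K.graph.Adj x y ↔ x ≠ y ∧ ∃ a b, G.graph.Adj a b ∧ φ a = x ∧ φ b = y

/-- `H` is a minor of `G`: a graph isomorphic to `H` can be obtained from a subgraph of `G` by
performing any number of edge contractions. -/
def IsMinor (H G : FinGraph) : Prop :=
  ∃ (S : G.graph.Subgraph) (K : FinGraph),
    Relation.ReflTransGen IsEdgeContraction (G.ofSubgraph S) K ∧ Nonempty (K.graph ≃g H.graph)

/-- The vertices of the subdivision of `G` in which each edge `e` is subdivided `k e` times: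
the vertices of `G` and, for each edge `e`, `k e` new vertices. -/
abbrev SubdivisionVertex (G : FinGraph) (k : G.graph.edgeSet → ℕ) : Type :=
  G.V ⊕ (Σ e : G.graph.edgeSet, Fin (k e))

/-- The vertices at positions `0, 1, …, k e + 1` of the path replacing the edge `e`: positions `0`
and `k e + 1` are the two ends of `e` (in an arbitrarily chosen order), the others are new. -/
noncomputable def subdivisionPath (G : FinGraph) (k : G.graph.edgeSet → ℕ) (e : G.graph.edgeSet)
    (i : ℕ) : G.SubdivisionVertex k :=
  if i = 0 then Sum.inl (Quot.out e.1).1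
  else if h : i - 1 < k e then Sum.inr ⟨e, ⟨i - 1, h⟩⟩
  else Sum.inl (Quot.out e.1).2

/-- The subdivision of `G` in which each edge `e` is replaced by a path with `k e` internal
vertices. -/
noncomputable abbrev subdivision (G : FinGraph) (k : G.graph.edgeSet → ℕ) : FinGraph where
  V := G.SubdivisionVertex k
  finite := by
    have := G.finite
    infer_instance
  graph := SimpleGraph.fromRel fun x y =>
    ∃ (e : G.graph.edgeSet) (i : ℕ), i ≤ k e ∧
      x = G.subdivisionPath k e i ∧ y = G.subdivisionPath k e (i + 1)

/-- An unweighted graph as a weighted graph: every edge has weight `1`. -/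
abbrev toWeighted (G : FinGraph) : WeightedGraph where
  toFinGraph := G
  weight := fun _ => 1
  weight_pos := fun _ => one_pos

end FinGraph

namespace WeightedGraph

/-- The length of a walk: the sum of the weights of its edges. -/
noncomputable def walkLength (G : WeightedGraph) : ∀ {u v : G.V}, G.graph.Walk u v → ℝ≥0∞
  | _, _, .nil => 0
  | _, _, .cons h p => G.weight ⟨_, (SimpleGraph.mem_edgeSet _).2 h⟩ + G.walkLength p

/-- The length of a shortest path from `u` to `v`, or `∞` if there is no path. -/
noncomputable def dist (G : WeightedGraph) (u v : G.V) : ℝ≥0∞ :=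
  ⨅ (p : G.graph.Walk u v) (_ : p.IsPath), G.walkLength p

/-- The weak diameter in `G` of a set of vertices. -/
noncomputable def weakDiam (G : WeightedGraph) (S : Set G.V) : ℝ≥0∞ :=
  ⨆ (u ∈ S) (v ∈ S), G.dist u v

/-- The `r`-th power of `G`: distinct vertices are adjacent if they are at distance at most `r`
(symmetrised by `fromRel`; the distance is symmetric). -/
def power (G : WeightedGraph) (r : ℝ) : SimpleGraph G.V :=
  SimpleGraph.fromRel fun u v => G.dist u v ≤ ENNReal.ofReal r

/-- `c` is an `(m, r, d)`-colouring of `G`: every monochromatic `r`-component of `G` has weak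
diameter in `G` at most `d`. The `i`-monochromatic `r`-components are the connected components of
the subgraph of the `r`-th power of `G` induced by the vertices of colour `i`. -/
def IsColouring (G : WeightedGraph) {m : ℕ} (r d : ℝ) (c : G.V → Fin m) : Prop :=
  ∀ (i : Fin m) (M : ((G.power r).induce {v | c v = i}).ConnectedComponent),
    G.weakDiam (Subtype.val '' M.supp) ≤ ENNReal.ofReal d

/-- `f` is an `n`-dimensional control function for `G`. -/
def IsControlFunction (G : WeightedGraph) (n : ℕ) (f : PosReal → PosReal) : Prop :=
  ∀ r : PosReal, ∃ c : G.V → Fin (n + 1), G.IsColouring r (f r) c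

end WeightedGraph

/-- `f` is an `n`-dimensional control function for a class of weighted graphs. -/
def IsClassControlFunction (𝒲 : Set WeightedGraph) (n : ℕ) (f : PosReal → PosReal) : Prop :=
  ∀ G ∈ 𝒲, G.IsControlFunction n f

/-- `f` is a dilation. -/
def IsDilation (f : PosReal → PosReal) : Prop :=
  ∃ c : ℝ, 0 < c ∧ ∀ r : PosReal, (f r : ℝ) ≤ c * r

/-- The asymptotic dimension of a class of weighted graphs: the least `n` for which there is an
`n`-dimensional control function, or `∞` if there is none. -/
noncomputable def asdim (𝒲 : Set WeightedGraph) : ℕ∞ :=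
  ⨅ (n : ℕ) (_ : ∃ f, IsClassControlFunction 𝒲 n f), (n : ℕ∞)

/-- The Assouad–Nagata dimension of a class of weighted graphs: the least `n` for which there is an
`n`-dimensional control function that is a dilation, or `∞` if there is none. -/
noncomputable def ANdim (𝒲 : Set WeightedGraph) : ℕ∞ :=
  ⨅ (n : ℕ) (_ : ∃ f, IsDilation f ∧ IsClassControlFunction 𝒲 n f), (n : ℕ∞)

namespace GraphClass

/-- `H` is a minor of some graph in the class. -/
def AdmitsMinor (𝒢 : GraphClass) (H : FinGraph) : Prop :=
  ∃ G ∈ 𝒢.carrier, H.IsMinor G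

/-- Every subdivision of a graph in the class is in the class. -/
def SubdivisionClosed (𝒢 : GraphClass) : Prop :=
  ∀ G ∈ 𝒢.carrier, ∀ k : G.graph.edgeSet → ℕ, G.subdivision k ∈ 𝒢.carrier

/-- The `S`-weights completion of a class of graphs: all weighted graphs with edge weights in `S`
whose underlying unweighted graph is in the class. -/
def weightsCompletion (𝒢 : GraphClass) (S : Set PosReal) : Set WeightedGraph :=
  {G | G.toFinGraph ∈ 𝒢.carrier ∧ ∀ e, ∃ s ∈ S, G.weight e = ENNReal.ofReal s}

/-- A class of unweighted graphs as a class of weighted graphs, all edges having weight `1`. -/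
def toWeighted (𝒢 : GraphClass) : Set WeightedGraph :=
  FinGraph.toWeighted '' 𝒢.carrier

end GraphClass

/-- The set `{1, 2, …}` of positive integers inside `ℝ⁺`. -/
def posIntegers : Set PosReal :=
  {x | ∃ n : ℕ, (x : ℝ) = n}

/-! Fix `n` and `D`. The obstruction is a finite `(n + 3)`-regular Cayley graph X, generated by
involutions, in which distinct reduced words of length at most `D + 1` represent distinct elements.
Colour X with `n + 1` colours and join vertices of one colour that have a common neighbour. Some
component then has diameter above `D`. Otherwise pick a representative in each component and write
each vertex x as a reduced word of length at most `D` times its representative. At least `n + 2`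
generators prolong this word. Sending x and such a generator to the neighbour reached and the colour
of x is injective: equal images put both vertices in one component, and the prolonged words,
starting from one representative and having equal ends, coincide. So `(n + 2)|X| ≤ (n + 1)|X|`,
which is absurd (`cayleyGraph_not_colourable`).

Now let X be a minor of G. Make edges inside branch sets very short, the other edges of the model of
length N, and all remaining edges so long that they are useless as shortcuts. Up to a factor 3,
representatives of the branch sets then see the metric of X scaled by N, as far as distance `D`
(`IsMinor.exists_lengths`). So at scale `6N`, components bounded by `DN` are impossible. Rescaling
by `1/N` fixes the scale at 6 and excludes every control function. Without rescaling the lengths are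
integers, realised by weights or by subdivision, and the unbounded ratio excludes linear control. -/

namespace WeightedGraph

/-! ### Weighted distance and edge lengths -/

variable (G : WeightedGraph)

theorem walkLength_append {u v w : G.V} (p : G.graph.Walk u v) (q : G.graph.Walk v w) :
    G.walkLength (p.append q) = G.walkLength p + G.walkLength q := by
  induction p with
  | nil => simp [walkLength]
  | cons h p ih => simp [walkLength, ih, add_assoc]

theorem walkLength_reverse {u v : G.V} (p : G.graph.Walk u v) :
    G.walkLength p.reverse = G.walkLength p := by
  induction p with
  | nil => simp [walkLength]
  | @cons a b c h p ih =>
    have hs : (⟨s(b, a), (SimpleGraph.mem_edgeSet _).2 h.symm⟩ : G.graph.edgeSet) =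
        ⟨s(a, b), (SimpleGraph.mem_edgeSet _).2 h⟩ := Subtype.ext Sym2.eq_swap
    simp [walkLength, walkLength_append, ih, hs, add_comm]

theorem walkLength_dropUntil_le [DecidableEq G.V] {u v w : G.V} (p : G.graph.Walk u v)
    (h : w ∈ p.support) : G.walkLength (p.dropUntil w h) ≤ G.walkLength p := by
  conv_rhs => rw [← p.take_spec h, walkLength_append]
  exact le_add_self

theorem walkLength_bypass_le [DecidableEq G.V] {u v : G.V} (p : G.graph.Walk u v) :
    G.walkLength p.bypass ≤ G.walkLength p := by
  induction p with
  | nil => simp [SimpleGraph.Walk.bypass]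
  | cons h p ih =>
    simp only [SimpleGraph.Walk.bypass]
    split_ifs with hs
    · exact (G.walkLength_dropUntil_le _ hs).trans (ih.trans le_add_self)
    · simp only [walkLength]
      gcongr

theorem dist_le_walkLength {u v : G.V} (p : G.graph.Walk u v) : G.dist u v ≤ G.walkLength p := by
  classical
  exact (iInf₂_le p.bypass p.bypass_isPath).trans (G.walkLength_bypass_le p)

theorem le_dist_iff {u v : G.V} {d : ℝ≥0∞} :
    d ≤ G.dist u v ↔ ∀ p : G.graph.Walk u v, d ≤ G.walkLength p :=
  ⟨fun h p => h.trans (G.dist_le_walkLength p), fun h => le_iInf₂ fun p _ => h p⟩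

theorem dist_self (u : G.V) : G.dist u u = 0 :=
  le_antisymm (G.dist_le_walkLength .nil) bot_le

theorem dist_comm (u v : G.V) : G.dist u v = G.dist v u := by
  have key : ∀ u v : G.V, G.dist u v ≤ G.dist v u := fun u v =>
    G.le_dist_iff.2 fun p => (G.walkLength_reverse p) ▸ G.dist_le_walkLength p.reverse
  exact le_antisymm (key u v) (key v u)

theorem dist_triangle (u v w : G.V) : G.dist u w ≤ G.dist u v + G.dist v w := by
  simp only [dist, ENNReal.iInf_add, ENNReal.add_iInf]
  exact le_iInf₂ fun p _ => le_iInf₂ fun q _ =>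
    (G.dist_le_walkLength (q.append p)).trans (G.walkLength_append q p).le

theorem dist_le_weight {u v : G.V} (h : G.graph.Adj u v) :
    G.dist u v ≤ G.weight ⟨s(u, v), (SimpleGraph.mem_edgeSet _).2 h⟩ := by
  simpa [walkLength] using G.dist_le_walkLength (SimpleGraph.Walk.cons h .nil)

/-- A function that changes along each edge by at most the weight of the edge bounds the distance
from below. -/
theorem ofReal_sub_le_dist (φ : G.V → ℝ)
    (hφ : ∀ (a b : G.V) (h : G.graph.Adj a b),
      ENNReal.ofReal (φ a - φ b) ≤ G.weight ⟨s(a, b), (SimpleGraph.mem_edgeSet _).2 h⟩)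
    (u v : G.V) : ENNReal.ofReal (φ u - φ v) ≤ G.dist u v := by
  refine G.le_dist_iff.2 fun p => ?_
  induction p with
  | nil => simp
  | @cons a b c h p ih =>
    calc ENNReal.ofReal (φ a - φ c) = ENNReal.ofReal ((φ a - φ b) + (φ b - φ c)) := by ring_nf
      _ ≤ _ := ENNReal.ofReal_add_le
      _ ≤ _ := add_le_add (hφ a b h) ih

/-- Vertices in one monochromatic component of a colouring are close to each other. -/
theorem IsColouring.dist_le {G : WeightedGraph} {m : ℕ} {r d : ℝ} {c : G.V → Fin m}
    (hc : G.IsColouring r d c) {i : Fin m} {x y : {v | c v = i}}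
    (h : ((G.power r).induce {v | c v = i}).Reachable x y) :
    G.dist x y ≤ ENNReal.ofReal d := by
  refine le_trans ?_ (hc i (SimpleGraph.connectedComponentMk _ x))
  have hx : (x : G.V) ∈ Subtype.val ''
      (((G.power r).induce {v | c v = i}).connectedComponentMk x).supp := ⟨x, rfl, rfl⟩
  have hy : (y : G.V) ∈ Subtype.val ''
      (((G.power r).induce {v | c v = i}).connectedComponentMk x).supp :=
    ⟨y, SimpleGraph.ConnectedComponent.sound h.symm, rfl⟩
  exact le_iSup₂_of_le _ hx (le_iSup₂_of_le _ hy le_rfl)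

/-- `W` contains the vertices of `G` in such a way that the distances in `W` between them are
those of the edge lengths `ℓ` on `G`. -/
structure Realizes (W : WeightedGraph) (G : FinGraph) (ℓ : Sym2 G.V → ℝ) (ι : G.V → W.V) :
    Prop where
  dist_le : ∀ a b, G.graph.Adj a b → W.dist (ι a) (ι b) ≤ ENNReal.ofReal (ℓ s(a, b))
  le_dist : ∀ φ : G.V → ℝ, (∀ a b, G.graph.Adj a b → φ a - φ b ≤ ℓ s(a, b)) →
    ∀ a b, ENNReal.ofReal (φ a - φ b) ≤ W.dist (ι a) (ι b)

/-- A path in `J` has fewer edges than `G` has vertices. This bounds the diameter of a branch set.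
-/
theorem Realizes.dist_le_of_reachable {W : WeightedGraph} {G : FinGraph} {ℓ : Sym2 G.V → ℝ}
    {ι : G.V → W.V} (hW : W.Realizes G ℓ ι) {J : SimpleGraph G.V} {t : ℝ} (ht : 0 ≤ t)
    (hJ : ∀ a b, J.Adj a b → G.graph.Adj a b ∧ ℓ s(a, b) ≤ t) {a b : G.V} (hab : J.Reachable a b) :
    W.dist (ι a) (ι b) ≤ ENNReal.ofReal (Nat.card G.V * t) := by
  classical
  have := G.finite
  have := Fintype.ofFinite G.V
  have key : ∀ {a b : G.V} (p : J.Walk a b),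
      W.dist (ι a) (ι b) ≤ ENNReal.ofReal (p.length * t) := by
    intro a b p
    induction p with
    | nil => simp [W.dist_self]
    | @cons a b c h p ih =>
      refine (W.dist_triangle _ (ι b) _).trans ?_
      rw [SimpleGraph.Walk.length_cons, Nat.cast_add, add_mul, Nat.cast_one, one_mul,
        ENNReal.ofReal_add (by positivity) ht, add_comm]
      obtain ⟨h1, h2⟩ := hJ a b h
      exact add_le_add ih ((hW.dist_le a b h1).trans (ENNReal.ofReal_le_ofReal h2))
  obtain ⟨p, hp⟩ := hab.exists_isPath
  refine (key p).trans (ENNReal.ofReal_le_ofReal ?_)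
  have := hp.length_lt
  rw [← Nat.card_eq_fintype_card] at this
  gcongr

end WeightedGraph

/-! ### Realising lengths by weights and by subdivision -/

namespace FinGraph

/-- The graph `G` with edge lengths `ℓ`. -/
noncomputable abbrev withLengths (G : FinGraph) (ℓ : Sym2 G.V → ℝ) (hℓ : ∀ e, 0 < ℓ e) :
    WeightedGraph where
  toFinGraph := G
  weight := fun e => ENNReal.ofReal (ℓ e)
  weight_pos := fun e => ENNReal.ofReal_pos.2 (hℓ e)

theorem withLengths_realizes (G : FinGraph) (ℓ : Sym2 G.V → ℝ) (hℓ : ∀ e, 0 < ℓ e) :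
    (G.withLengths ℓ hℓ).Realizes G ℓ id where
  dist_le _ _ h := (G.withLengths ℓ hℓ).dist_le_weight h
  le_dist φ hφ := (G.withLengths ℓ hℓ).ofReal_sub_le_dist φ
    fun a b h => ENNReal.ofReal_le_ofReal (hφ a b h)

section Subdivision

variable (G : FinGraph) (k : G.graph.edgeSet → ℕ)

theorem subdivisionPath_zero (e : G.graph.edgeSet) :
    G.subdivisionPath k e 0 = Sum.inl (Quot.out e.1).1 := if_pos rfl

theorem subdivisionPath_last (e : G.graph.edgeSet) :
    G.subdivisionPath k e (k e + 1) = Sum.inl (Quot.out e.1).2 := by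
  simp [subdivisionPath]

/-- The linear extension of a function on the vertices of `G` to a subdivision. -/
noncomputable def linearExtension (φ : G.V → ℝ) : G.SubdivisionVertex k → ℝ
  | .inl a => φ a
  | .inr ⟨e, i⟩ => φ (Quot.out e.1).1 +
      (φ (Quot.out e.1).2 - φ (Quot.out e.1).1) * ((i + 1 : ℕ) / (k e + 1 : ℝ))

theorem linearExtension_subdivisionPath (φ : G.V → ℝ) (e : G.graph.edgeSet) {i : ℕ}
    (hi : i ≤ k e + 1) : G.linearExtension k φ (G.subdivisionPath k e i) =
      φ (Quot.out e.1).1 + (φ (Quot.out e.1).2 - φ (Quot.out e.1).1) * (i / (k e + 1 : ℝ)) := by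
  unfold subdivisionPath
  split_ifs with h0 h1
  · simp [h0, linearExtension]
  · simp only [linearExtension]
    rw [Nat.sub_add_cancel (by omega)]
  · obtain rfl : i = k e + 1 := by omega
    have : (k e + 1 : ℝ) ≠ 0 := by positivity
    simp [linearExtension, div_self this]

theorem subdivision_dist_out_le (e : G.graph.edgeSet) :
    (G.subdivision k).toWeighted.dist (Sum.inl (Quot.out e.1).1) (Sum.inl (Quot.out e.1).2) ≤
      ENNReal.ofReal (k e + 1) := by
  have key : ∀ i : ℕ, i ≤ k e + 1 → (G.subdivision k).toWeighted.dist
      (G.subdivisionPath k e 0) (G.subdivisionPath k e i) ≤ i := by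
    intro i
    induction i with
    | zero => intro _; simp [WeightedGraph.dist_self]
    | succ i ih =>
      intro hi
      refine (WeightedGraph.dist_triangle _ _ (G.subdivisionPath k e i) _).trans ?_
      rw [Nat.cast_add, Nat.cast_one]
      refine add_le_add (ih (by omega)) ?_
      by_cases hne : G.subdivisionPath k e i = G.subdivisionPath k e (i + 1)
      · rw [← hne, WeightedGraph.dist_self]; exact bot_le
      · exact (G.subdivision k).toWeighted.dist_le_weight
          ((SimpleGraph.fromRel_adj _ _ _).2 ⟨hne, Or.inl ⟨e, i, by omega, rfl, rfl⟩⟩)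
  have := key (k e + 1) le_rfl
  rw [subdivisionPath_zero, subdivisionPath_last] at this
  rwa [show (k e + 1 : ℝ) = ((k e + 1 : ℕ) : ℝ) by push_cast; rfl, ENNReal.ofReal_natCast]

/-- The upper bound follows the path replacing an edge. For the lower bound, linear interpolation
spreads a change of at most `k e + 1` evenly over `k e + 1` unit edges. -/
theorem subdivision_realizes (ℓ : Sym2 G.V → ℝ) (hℓ : ∀ e : G.graph.edgeSet, ℓ e = k e + 1) :
    (G.subdivision k).toWeighted.Realizes G ℓ Sum.inl where
  dist_le a b h := by
    let e : G.graph.edgeSet := ⟨s(a, b), h⟩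
    have hle := G.subdivision_dist_out_le k e
    rw [← hℓ e] at hle
    have hout : s((Quot.out e.1).1, (Quot.out e.1).2) = s(a, b) := Quot.out_eq e.1
    rcases Sym2.eq_iff.1 hout with ⟨h1, h2⟩ | ⟨h1, h2⟩
    · rwa [h1, h2] at hle
    · rw [h1, h2] at hle
      rwa [WeightedGraph.dist_comm]
  le_dist φ hφ a b := by
    refine (G.subdivision k).toWeighted.ofReal_sub_le_dist (G.linearExtension k φ) ?_
      (Sum.inl a) (Sum.inl b)
    have key : ∀ (e : G.graph.edgeSet) (i : ℕ), i ≤ k e →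
        |G.linearExtension k φ (G.subdivisionPath k e i) -
          G.linearExtension k φ (G.subdivisionPath k e (i + 1))| ≤ 1 := by
      intro e i hi
      have hout : s((Quot.out e.1).1, (Quot.out e.1).2) = e.1 := Quot.out_eq e.1
      have hadj : G.graph.Adj (Quot.out e.1).1 (Quot.out e.1).2 := by
        rw [← SimpleGraph.mem_edgeSet, hout]; exact e.2
      have h1 := hφ _ _ hadj
      have h2 := hφ _ _ hadj.symm
      rw [Sym2.eq_swap] at h2
      rw [hout, hℓ e] at h1 h2
      rw [linearExtension_subdivisionPath _ _ _ _ (by omega),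
        linearExtension_subdivisionPath _ _ _ _ (by omega)]
      have hpos : (0 : ℝ) < k e + 1 := by positivity
      rw [show ∀ x y : ℝ, x + (y - x) * (i / (k e + 1 : ℝ)) -
        (x + (y - x) * ((i + 1 : ℕ) / (k e + 1 : ℝ))) = (x - y) / (k e + 1) by
          intro x y; push_cast; ring, abs_div, abs_of_pos hpos, div_le_one hpos]
      exact abs_le.2 ⟨by linarith, h1⟩
    intro x y h
    refine ENNReal.ofReal_le_one.2 ?_
    rcases ((SimpleGraph.fromRel_adj _ _ _).1 h).2 with ⟨e, i, hi, rfl, rfl⟩ | ⟨e, i, hi, rfl, rfl⟩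
    · exact (le_abs_self _).trans (key e i hi)
    · exact (le_abs_self _).trans ((abs_sub_comm _ _).le.trans (key e i hi))

end Subdivision

end FinGraph

/-! ### Minors and the metric on branch sets -/

namespace FinGraph

/-- `φ` maps the vertices of `G` to those of `K` such that the fibres are connected and `K` is the
simple graph obtained from `G` by contracting them. -/
structure IsContractionMap (G K : FinGraph) (φ : G.V → K.V) : Prop where
  surjective : Function.Surjective φ
  fibre : ∀ a b, φ a = φ b →
    Relation.ReflTransGen (fun x y => G.graph.Adj x y ∧ φ x = φ y) a b
  adj_iff : ∀ x y, K.graph.Adj x y ↔ x ≠ y ∧ ∃ a b, G.graph.Adj a b ∧ φ a = x ∧ φ b = y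

theorem isContractionMap_id (G : FinGraph) : IsContractionMap G G id where
  surjective := Function.surjective_id
  fibre := by rintro a _ rfl; exact .refl
  adj_iff x y := ⟨fun h => ⟨h.ne, x, y, h, rfl, rfl⟩, by rintro ⟨_, a, b, h, rfl, rfl⟩; exact h⟩

/-- A new fibre is an old one or the union of the two over `u` and `v`, which an edge of `G` joins
because `u` and `v` are adjacent in `K`. -/
theorem IsContractionMap.edgeContraction {G K L : FinGraph} {φ : G.V → K.V}
    (hφ : IsContractionMap G K φ) (hKL : IsEdgeContraction K L) :
    ∃ ψ : G.V → L.V, IsContractionMap G L ψ := by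
  obtain ⟨u, v, huv, θ, hθ, heq, hadj⟩ := hKL
  refine ⟨θ ∘ φ, hθ.comp hφ.surjective, ?_, ?_⟩
  · intro a b hab
    have lift : ∀ a b, φ a = φ b →
        Relation.ReflTransGen (fun x y => G.graph.Adj x y ∧ θ (φ x) = θ (φ y)) a b :=
      fun a b h => (hφ.fibre a b h).lift id fun x y hxy => ⟨hxy.1, congrArg θ hxy.2⟩
    rcases (heq _ _).1 hab with h | h
    · exact lift a b h
    · have hK : K.graph.Adj (φ a) (φ b) := by
        rw [← SimpleGraph.mem_edgeSet, h]; exact huv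
      obtain ⟨_, a', b', h', ha, hb⟩ := (hφ.adj_iff _ _).1 hK
      refine (lift a a' ha.symm).trans (.head ⟨h', ?_⟩ (lift b' b hb))
      rw [ha, hb]; exact hab
  · intro x y
    rw [hadj]
    refine and_congr_right fun hne => ⟨?_, ?_⟩
    · rintro ⟨a, b, hab, rfl, rfl⟩
      obtain ⟨_, a', b', h', rfl, rfl⟩ := (hφ.adj_iff _ _).1 hab
      exact ⟨a', b', h', rfl, rfl⟩
    · rintro ⟨a, b, hab, rfl, rfl⟩
      exact ⟨φ a, φ b, (hφ.adj_iff _ _).2 ⟨fun h => hne (congrArg θ h), a, b, hab, rfl, rfl⟩,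
        rfl, rfl⟩

theorem IsContractionMap.iso {G K L : FinGraph} {φ : G.V → K.V}
    (hφ : IsContractionMap G K φ) (f : K.graph ≃g L.graph) : IsContractionMap G L (f ∘ φ) where
  surjective := f.surjective.comp hφ.surjective
  fibre a b h := (hφ.fibre a b (f.injective h)).lift id fun _ _ hxy => ⟨hxy.1, congrArg f hxy.2⟩
  adj_iff x y := by
    obtain ⟨x, rfl⟩ := f.surjective x
    obtain ⟨y, rfl⟩ := f.surjective y
    simp [f.map_adj_iff, hφ.adj_iff]

theorem IsMinor.exists_isContractionMap {H G : FinGraph} (h : H.IsMinor G) :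
    ∃ (S : G.graph.Subgraph) (φ : S.verts → H.V), IsContractionMap (G.ofSubgraph S) H φ := by
  obtain ⟨S, K, hSK, ⟨f⟩⟩ := h
  obtain ⟨φ, hφ⟩ : ∃ φ, IsContractionMap (G.ofSubgraph S) K φ := by
    clear f
    induction hSK with
    | refl => exact ⟨id, isContractionMap_id _⟩
    | tail _ hc ih => obtain ⟨φ, hφ⟩ := ih; exact hφ.edgeContraction hc
  exact ⟨S, _, hφ.iso f⟩

/-- The distance from `u`, truncated at `D`. -/
noncomputable def truncDist (H : FinGraph) (D : ℕ) (u v : H.V) : ℕ :=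
  (min (H.graph.edist u v) D).toNat

theorem coe_truncDist (H : FinGraph) (D : ℕ) (u v : H.V) :
    (H.truncDist D u v : ℕ∞) = min (H.graph.edist u v) D :=
  ENat.natCast_toNat (ne_top_of_le_ne_top (ENat.natCast_ne_top D) (min_le_right _ _))

theorem truncDist_le (H : FinGraph) (D : ℕ) (u v : H.V) : H.truncDist D u v ≤ D := by
  exact_mod_cast (H.coe_truncDist D u v).le.trans (min_le_right _ _)

theorem truncDist_le_succ (H : FinGraph) (D : ℕ) (u : H.V) {v w : H.V} (h : H.graph.Adj v w) :
    H.truncDist D u w ≤ H.truncDist D u v + 1 := by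
  have h1 : H.graph.edist u w ≤ H.graph.edist u v + 1 := by
    refine (SimpleGraph.edist_triangle (v := v)).trans ?_
    rw [SimpleGraph.edist_eq_one_iff_adj.2 h]
  have : (H.truncDist D u w : ℕ∞) ≤ H.truncDist D u v + 1 := by
    rw [coe_truncDist, coe_truncDist, ← min_add_add_right]
    exact min_le_min h1 le_self_add
  exact_mod_cast this

/-- Truncation one step beyond `D` leaves values up to `D` unchanged. -/
theorem edist_le_of_truncDist_le (H : FinGraph) {D : ℕ} {u v : H.V}
    (h : H.truncDist (D + 1) u v ≤ D) : H.graph.edist u v ≤ D := by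
  have h' : (H.truncDist (D + 1) u v : ℕ∞) ≤ D := by exact_mod_cast h
  rw [coe_truncDist, min_le_iff] at h'
  refine h'.resolve_right fun h'' => ?_
  have : D + 1 ≤ D := by exact_mod_cast h''
  omega

open Classical in
/-- Lengths `1` for the edges of `S` inside a fibre of `φ`, `N` for the other edges of `S`, and
`M` for the remaining edges. -/
noncomputable def minorLength {G H : FinGraph} (S : G.graph.Subgraph) (φ : S.verts → H.V)
    (N M : ℕ) (e : Sym2 G.V) : ℕ :=
  if ∃ a b : S.verts, e = s(a.1, b.1) ∧ S.coe.Adj a b ∧ φ a = φ b then 1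
  else if e ∈ S.edgeSet then N else M

/-- If `H` is a minor of `G`, then for suitable edge lengths on `G` the metric of `G` restricted to
representatives of the branch sets resembles that of `H`. -/
theorem IsMinor.exists_lengths {H G : FinGraph} (h : H.IsMinor G) (D : ℕ) :
    ∃ N : ℕ, 0 < N ∧ ∃ w : Sym2 G.V → ℕ, (∀ e, 0 < w e) ∧ ∃ ρ : H.V → G.V,
      ∀ t : ℝ, 0 < t → ∀ (W : WeightedGraph) (ι : G.V → W.V),
        W.Realizes G (fun e => t * w e) ι →
        (∀ u v, H.graph.Adj u v → W.dist (ι (ρ u)) (ι (ρ v)) ≤ ENNReal.ofReal (3 * N * t)) ∧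
        (∀ u v, W.dist (ι (ρ u)) (ι (ρ v)) < ENNReal.ofReal (N * (D + 1) * t) →
          H.graph.edist u v ≤ D) := by
  classical
  obtain ⟨S, φ, hφ⟩ := h.exists_isContractionMap
  obtain ⟨σ, hσ⟩ := hφ.surjective.hasRightInverse
  -- With unit edges inside, a branch set has diameter less than `N`. The length `N * (D + 1)` of
  -- the unused edges is the maximum of the potential `ψ` at `t = 1`.
  set N := Nat.card G.V + 1 with hN
  have hN0 : 0 < N := Nat.succ_pos _
  set w := minorLength S φ N (N * (D + 1)) with hw
  have w_fibre : ∀ a b : S.verts, S.coe.Adj a b → φ a = φ b → w s(a.1, b.1) = 1 :=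
    fun a b h1 h2 => if_pos ⟨a, b, rfl, h1, h2⟩
  have w_sub : ∀ a b : S.verts, S.coe.Adj a b → w s(a.1, b.1) ≤ N := by
    intro a b h1
    rw [hw, minorLength]
    split_ifs with h2 h3
    · omega
    · exact le_rfl
    · exact absurd h1 h3
  refine ⟨N, hN0, w, fun e => ?_, fun x => (σ x).1, fun t ht W ι hW => ⟨fun u v huv => ?_, ?_⟩⟩
  · rw [hw, minorLength]; split_ifs <;> positivity
  · have inner : ∀ a b : S.verts, φ a = φ b →
        W.dist (ι a.1) (ι b.1) ≤ ENNReal.ofReal (N * t) := by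
      intro a b hab
      let J : SimpleGraph G.V := SimpleGraph.fromRel fun x y =>
        ∃ a b : S.verts, a.1 = x ∧ b.1 = y ∧ S.coe.Adj a b ∧ φ a = φ b
      have hJ : ∀ x y, J.Adj x y → G.graph.Adj x y ∧ t * w s(x, y) ≤ t := by
        intro x y hxy
        rcases ((SimpleGraph.fromRel_adj _ _ _).1 hxy).2 with
          ⟨a, b, rfl, rfl, h1, h2⟩ | ⟨a, b, rfl, rfl, h1, h2⟩
        · exact ⟨S.adj_sub h1, by simp [w_fibre a b h1 h2]⟩
        · exact ⟨(S.adj_sub h1).symm, by rw [Sym2.eq_swap]; simp [w_fibre a b h1 h2]⟩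
      have hreach : J.Reachable a.1 b.1 := by
        have := hφ.fibre a b hab
        clear hab
        induction this with
        | refl => exact .refl _
        | @tail x y _ hxy ih =>
          have hxy' : (x : S.verts).1 ≠ y.1 := (S.adj_sub hxy.1).ne
          exact ih.trans (SimpleGraph.Adj.reachable
            ((SimpleGraph.fromRel_adj _ _ _).2 ⟨hxy', Or.inl ⟨x, y, rfl, rfl, hxy⟩⟩))
      refine (hW.dist_le_of_reachable ht.le hJ hreach).trans (ENNReal.ofReal_le_ofReal ?_)
      rw [hN]; push_cast; gcongr; linarith
    -- The factor 3: within the branch set of `u`, across one edge, within that of `v`.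
    obtain ⟨_, a, b, hab, ha, hb⟩ := (hφ.adj_iff _ _).1 huv
    have h1 := inner (σ u) a ((hσ u).trans ha.symm)
    have h2 : W.dist (ι a.1) (ι b.1) ≤ ENNReal.ofReal (N * t) := by
      refine (hW.dist_le _ _ (S.adj_sub hab)).trans (ENNReal.ofReal_le_ofReal ?_)
      have : (w s(a.1, b.1) : ℝ) ≤ N := by exact_mod_cast w_sub a b hab
      rw [mul_comm]; gcongr
    have h3 := inner b (σ v) (hb.trans (hσ v).symm)
    have hnt : 0 ≤ (N : ℝ) * t := by positivity
    rw [show 3 * (N : ℝ) * t = N * t + (N * t + N * t) by ring, ENNReal.ofReal_add hnt (by positivity),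
      ENNReal.ofReal_add hnt hnt]
    exact (W.dist_triangle _ _ _).trans (add_le_add h1
      ((W.dist_triangle _ _ _).trans (add_le_add h2 h3)))
  · intro u v huv
    let τ : H.V → ℕ := H.truncDist (D + 1) u
    -- This potential is constant on branch sets. Truncation keeps it within the length of an edge
    -- outside `S`, so the value 0 off `S` is harmless.
    let ψ : G.V → ℝ := fun a => if h : a ∈ S.verts then t * (N * τ (φ ⟨a, h⟩)) else 0
    have hψ0 : ∀ a, 0 ≤ ψ a := fun a => by
      simp only [ψ]; split_ifs <;> positivity
    have hψM : ∀ a, ψ a ≤ t * (N * (D + 1)) := fun a => by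
      simp only [ψ]
      split_ifs with h
      · have : (τ (φ ⟨a, h⟩) : ℝ) ≤ D + 1 := by
          exact_mod_cast H.truncDist_le (D + 1) u _
        gcongr
      · positivity
    have hψS : ∀ a : S.verts, ψ a.1 = t * (N * τ (φ a)) := fun a => dif_pos a.2
    have hψ : ∀ a b, G.graph.Adj a b → ψ a - ψ b ≤ t * w s(a, b) := by
      intro a b _
      rw [hw, minorLength]
      split_ifs with h1 h2
      · obtain ⟨x, y, hxy, _, h3⟩ := h1
        have : ψ a - ψ b = 0 := by
          rcases Sym2.eq_iff.1 hxy with ⟨rfl, rfl⟩ | ⟨rfl, rfl⟩ <;> simp [hψS, h3]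
        rw [this]; positivity
      · have h2' : S.Adj a b := h2
        obtain ⟨x, rfl⟩ : ∃ x : S.verts, x.1 = a := ⟨⟨a, S.edge_vert h2'⟩, rfl⟩
        obtain ⟨y, rfl⟩ : ∃ y : S.verts, y.1 = b := ⟨⟨b, S.edge_vert h2'.symm⟩, rfl⟩
        have hne : φ x ≠ φ y := fun h => h1 ⟨x, y, rfl, h2', h⟩
        have hadj := (hφ.adj_iff _ _).2 ⟨hne.symm, y, x, h2'.symm, rfl, rfl⟩
        have : (τ (φ x) : ℝ) ≤ τ (φ y) + 1 := by
          exact_mod_cast H.truncDist_le_succ (D + 1) u hadj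
        rw [hψS, hψS, ← mul_sub, ← mul_sub]
        have h5 : (τ (φ x) : ℝ) - τ (φ y) ≤ 1 := by linarith
        have : (N : ℝ) * (τ (φ x) - τ (φ y)) ≤ N * 1 := by gcongr
        rw [mul_one] at this
        gcongr
      · push_cast
        linarith [hψ0 b, hψM a]
    have hlow := (hW.le_dist ψ hψ (σ v).1 (σ u).1).trans_lt (W.dist_comm _ _ ▸ huv)
    have hpos : (0 : ℝ) < N * (D + 1) * t := by positivity
    rw [ENNReal.ofReal_lt_ofReal_iff hpos, hψS, hψS, hσ, hσ] at hlow
    have hτu : τ u = 0 := by simp [τ, truncDist]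
    rw [hτu] at hlow
    have hlt : (N * t) * (τ v : ℝ) < (N * t) * (D + 1) := by
      push_cast at hlow; linarith
    have hlt' : (τ v : ℝ) < D + 1 := lt_of_mul_lt_mul_left hlt (by positivity)
    have hlt'' : τ v < D + 1 := by exact_mod_cast hlt'
    exact H.edist_le_of_truncDist_le (Nat.lt_succ_iff.1 hlt'')

end FinGraph

/-! ### Involutions acting on reduced words -/

/-- Words of length at most `R` without two equal consecutive letters. -/
abbrev ReducedWord (d R : ℕ) : Type :=
  {l : List (Fin d) // l.IsChain (· ≠ ·) ∧ l.length ≤ R}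

namespace ReducedWord

variable {d R : ℕ}

instance : Finite (ReducedWord d R) :=
  ((List.finite_length_le (Fin d) R).subset fun _ h => h.2).to_subtype

/-- The empty word. -/
def nil : ReducedWord d R := ⟨[], .nil, Nat.zero_le _⟩

theorem isChain_cons {i : Fin d} {l : List (Fin d)} (hl : l.IsChain (· ≠ ·))
    (h : l.head? ≠ some i) : (i :: l).IsChain (· ≠ ·) := by
  cases l with
  | nil => simp
  | cons a l => exact List.IsChain.cons_cons (fun h' => h (by simp [h'])) hl

/-- Multiplication by the letter `i`: cancel it against the first letter if possible, otherwise put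
it in front if there is room. -/
def pushFun (i : Fin d) (l : ReducedWord d R) : ReducedWord d R :=
  if l.1.head? = some i then
    ⟨l.1.tail, l.2.1.tail, by rw [List.length_tail]; exact (Nat.sub_le _ _).trans l.2.2⟩
  else if h : l.1.head? ≠ some i ∧ l.1.length < R then ⟨i :: l.1, isChain_cons l.2.1 h.1, h.2⟩
  else l

theorem pushFun_of_head {i : Fin d} {l : ReducedWord d R} (h : l.1.head? = some i) :
    (pushFun i l).1 = l.1.tail := by
  rw [pushFun, if_pos h]

theorem pushFun_of_lt {i : Fin d} {l : ReducedWord d R} (h : l.1.head? ≠ some i)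
    (hl : l.1.length < R) : (pushFun i l).1 = i :: l.1 := by
  rw [pushFun, if_neg h, dif_pos ⟨h, hl⟩]

theorem pushFun_of_ge {i : Fin d} {l : ReducedWord d R} (h : l.1.head? ≠ some i)
    (hl : ¬ l.1.length < R) : pushFun i l = l := by
  rw [pushFun, if_neg h, dif_neg fun h' => hl h'.2]

/-- After a cancellation the word is shorter and, being reduced, does not start with `i`, so `i` can
be put back. Full words not starting with `i` are fixed. -/
theorem pushFun_involutive (i : Fin d) : Function.Involutive (pushFun (R := R) i) := by
  intro l
  by_cases h : l.1.head? = some i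
  · have h1 := pushFun_of_head h
    obtain ⟨t, ht⟩ : ∃ t, l.1 = i :: t := ⟨l.1.tail, (List.cons_head?_tail h).symm⟩
    have hc := l.2.1
    have hl := l.2.2
    rw [ht, List.tail_cons] at h1
    rw [ht] at hc hl
    have h2 : (pushFun i l).1.head? ≠ some i := by
      rw [h1]
      cases t with
      | nil => simp
      | cons a t =>
        rw [List.isChain_cons_cons] at hc
        simpa using hc.1.symm
    exact Subtype.ext (by rw [pushFun_of_lt h2 (by rw [h1]; exact hl), h1, ht])
  · by_cases hl : l.1.length < R
    · have h1 := pushFun_of_lt h hl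
      exact Subtype.ext (by rw [pushFun_of_head (by rw [h1]; rfl), h1, List.tail_cons])
    · rw [pushFun_of_ge h hl, pushFun_of_ge h hl]

/-- The involution `pushFun i`, as a permutation. -/
def push (i : Fin d) : Equiv.Perm (ReducedWord d R) := (pushFun_involutive i).toPerm

theorem push_mul_self (i : Fin d) : push (R := R) i * push i = 1 :=
  Equiv.ext (pushFun_involutive i)

/-- The product of the involutions belonging to the letters of a word. -/
def eval (w : List (Fin d)) : Equiv.Perm (ReducedWord d R) := (w.map push).prod

theorem eval_cons (i : Fin d) (w : List (Fin d)) :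
    eval (R := R) (i :: w) = push i * eval w := by
  simp [eval]

/-- Letters are pushed from last to first: reducedness prevents cancellation and the length bound
leaves room. Hence the permutation remembers its word. -/
theorem eval_apply_nil {w : List (Fin d)} (hw : w.IsChain (· ≠ ·)) (hR : w.length ≤ R) :
    (eval w (nil : ReducedWord d R)).1 = w := by
  induction w with
  | nil => rfl
  | cons i w ih =>
    have h := ih hw.tail (Nat.le_of_succ_le hR)
    rw [eval_cons]
    refine (pushFun_of_lt ?_ ?_).trans (by rw [h])
    · rw [h]
      cases w with
      | nil => simp
      | cons a w =>
        rw [List.isChain_cons_cons] at hw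
        simpa using hw.1.symm
    · rw [h]; exact hR

theorem eval_injOn {w w' : List (Fin d)} (hw : w.IsChain (· ≠ ·)) (hR : w.length ≤ R)
    (hw' : w'.IsChain (· ≠ ·)) (hR' : w'.length ≤ R) (h : eval (R := R) w = eval w') : w = w' := by
  rw [← eval_apply_nil hw hR, h, eval_apply_nil hw' hR']

end ReducedWord

/-! ### The Cayley graph and its colourings -/

open ReducedWord

/-- The Cayley graph of the group of permutations of `ReducedWord d R` with respect to the
involutions `push i`. It is `d`-regular and has large girth when `R` is large. -/
def cayleyGraph (d R : ℕ) : SimpleGraph (Equiv.Perm (ReducedWord d R)) :=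
  SimpleGraph.fromRel fun g h => ∃ i, h = push i * g

theorem cayleyGraph_adj_iff {d R : ℕ} {g h : Equiv.Perm (ReducedWord d R)} :
    (cayleyGraph d R).Adj g h ↔ g ≠ h ∧ ∃ i, g = push i * h := by
  refine (SimpleGraph.fromRel_adj _ _ _).trans (and_congr_right fun _ => ⟨?_, fun h => Or.inr h⟩)
  rintro (⟨i, rfl⟩ | h)
  · exact ⟨i, by rw [← mul_assoc, push_mul_self, one_mul]⟩
  · exact h

theorem cayleyGraph_adj_push {d R : ℕ} (hR : 0 < R) (i : Fin d)
    (g : Equiv.Perm (ReducedWord d R)) : (cayleyGraph d R).Adj g (push i * g) := by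
  refine cayleyGraph_adj_iff.2 ⟨fun h => ?_, i, by rw [← mul_assoc, push_mul_self, one_mul]⟩
  have h1 : eval (R := R) [i] = eval [] := by
    rw [eval_cons]
    simpa [eval] using h
  simpa using eval_injOn (by simp) (Nat.succ_le_of_lt hR) (by simp) (by simp) h1

theorem exists_eval_of_walk {d R : ℕ} {g h : Equiv.Perm (ReducedWord d R)}
    (p : (cayleyGraph d R).Walk g h) :
    ∃ w : List (Fin d), w.IsChain (· ≠ ·) ∧ w.length ≤ p.length ∧
      g = eval w * h := by
  induction p with
  | nil => exact ⟨[], .nil, le_rfl, by simp [eval]⟩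
  | @cons a b c hab p ih =>
    obtain ⟨w, hw, hl, he⟩ := ih
    obtain ⟨_, i, hi⟩ := cayleyGraph_adj_iff.1 hab
    rw [he, ← mul_assoc, ← eval_cons] at hi
    rw [SimpleGraph.Walk.length_cons]
    by_cases h : w.head? = some i
    · obtain ⟨t, rfl⟩ : ∃ t, w = i :: t := ⟨w.tail, (List.cons_head?_tail h).symm⟩
      refine ⟨t, hw.tail, by rw [List.length_cons] at hl; omega, ?_⟩
      rw [hi, eval_cons, eval_cons, ← mul_assoc (push i), push_mul_self, one_mul]
    · exact ⟨i :: w, isChain_cons hw h, by rw [List.length_cons]; omega, hi⟩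

theorem exists_eval_of_edist_le {d R D : ℕ} {g h : Equiv.Perm (ReducedWord d R)}
    (hgh : (cayleyGraph d R).edist g h ≤ D) :
    ∃ w : List (Fin d), w.IsChain (· ≠ ·) ∧ w.length ≤ D ∧
      g = eval w * h := by
  obtain ⟨p, hp⟩ := SimpleGraph.exists_walk_of_edist_ne_top
    (ne_top_of_le_ne_top (ENat.natCast_ne_top D) hgh)
  rw [← hp] at hgh
  obtain ⟨w, hw, hl, he⟩ := exists_eval_of_walk p
  exact ⟨w, hw, hl.trans (by exact_mod_cast hgh), he⟩

/-- A colouring of a regular graph of large girth and degree at least `n + 3` with `n + 1` colours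
has large monochromatic components in the square of the graph. -/
theorem cayleyGraph_not_colourable (n D : ℕ) (c : Equiv.Perm (ReducedWord (n + 3) (D + 1)) → Fin (n + 1))
    (s : Setoid (Equiv.Perm (ReducedWord (n + 3) (D + 1))))
    (hs : ∀ x y z, (cayleyGraph (n + 3) (D + 1)).Adj x z →
      (cayleyGraph (n + 3) (D + 1)).Adj y z → c x = c y → s x y)
    (hD : ∀ x y, s x y → (cayleyGraph (n + 3) (D + 1)).edist x y ≤ D) : False := by
  let rep : Equiv.Perm (ReducedWord (n + 3) (D + 1)) → Equiv.Perm (ReducedWord (n + 3) (D + 1)) :=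
    fun x => (Quotient.mk s x).out
  have hrep : ∀ x, ∃ w : List (Fin (n + 3)), w.IsChain (· ≠ ·) ∧ w.length ≤ D ∧
      x = eval w * rep x := fun x =>
    exists_eval_of_edist_le (hD _ _ (s.symm (Quotient.mk_out x)))
  choose w hw hl he using hrep
  -- Skip the letter that would cancel the head of `w x`. For the empty word 0 is skipped
  -- arbitrarily, so that there are always `n + 2` choices.
  let letter : Equiv.Perm (ReducedWord (n + 3) (D + 1)) → Fin (n + 2) → Fin (n + 3) :=
    fun x j => ((w x).head?.getD 0).succAbove j
  have hchain : ∀ x j, (letter x j :: w x).IsChain (· ≠ ·) := fun x j =>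
    isChain_cons (hw x) fun h => by
      have : letter x j ≠ (w x).head?.getD 0 := Fin.succAbove_ne _ _
      rw [h] at this
      exact this rfl
  let Φ : Equiv.Perm (ReducedWord (n + 3) (D + 1)) × Fin (n + 2) →
      Equiv.Perm (ReducedWord (n + 3) (D + 1)) × Fin (n + 1) :=
    fun x => (push (letter x.1 x.2) * x.1, c x.1)
  have hΦ : Function.Injective Φ := by
    rintro ⟨x, j⟩ ⟨y, k⟩ hxy
    obtain ⟨h1, h2⟩ := Prod.mk.inj hxy
    dsimp only at h1 h2
    have hxs := cayleyGraph_adj_push (Nat.succ_pos D) (letter x j) x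
    rw [h1] at hxs
    have hsxy : s x y :=
      hs x y _ hxs (cayleyGraph_adj_push (Nat.succ_pos D) (letter y k) y) h2
    have hr : rep x = rep y := congrArg Quotient.out (Quotient.sound hsxy)
    have hlists : letter x j :: w x = letter y k :: w y := by
      refine eval_injOn (R := D + 1) (hchain x j) (Nat.succ_le_succ (hl x)) (hchain y k)
        (Nat.succ_le_succ (hl y)) ?_
      rw [eval_cons, eval_cons]
      refine mul_right_cancel (b := rep x) ?_
      rw [mul_assoc, ← he x, mul_assoc, hr, ← he y]
      exact h1
    obtain ⟨h3, h4⟩ := List.cons.inj hlists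
    obtain rfl : x = y := by rw [he x, h4, hr, ← he y]
    exact Prod.ext rfl (Fin.succAbove_right_injective h3)
  have hcard := Nat.card_le_card_of_injective Φ hΦ
  rw [Nat.card_prod, Nat.card_prod, Nat.card_fin, Nat.card_fin] at hcard
  have hpos : 0 < Nat.card (Equiv.Perm (ReducedWord (n + 3) (D + 1))) :=
    Nat.card_pos_iff.2 ⟨⟨1⟩, inferInstance⟩
  nlinarith

/-! ### Transfer to weighted graphs and conclusion -/

/-- A weighted graph containing representatives of the vertices of a regular graph of large girth,
with a metric resembling that of the regular graph, has no colouring with bounded components. -/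
theorem WeightedGraph.not_isColouring (W : WeightedGraph) (n D : ℕ) {r d r' : ℝ} (hr' : 0 ≤ r')
    (hr : 2 * r' ≤ r) (ρ : Equiv.Perm (ReducedWord (n + 3) (D + 1)) → W.V)
    (hadj : ∀ u v, (cayleyGraph (n + 3) (D + 1)).Adj u v →
      W.dist (ρ u) (ρ v) ≤ ENNReal.ofReal r')
    (hdist : ∀ u v, W.dist (ρ u) (ρ v) ≤ ENNReal.ofReal d →
      (cayleyGraph (n + 3) (D + 1)).edist u v ≤ D)
    (c : W.V → Fin (n + 1)) : ¬ W.IsColouring r d c := by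
  intro hc
  let s : Setoid (Equiv.Perm (ReducedWord (n + 3) (D + 1))) :=
    { r := fun x y => ∃ (i : Fin (n + 1)) (hx : c (ρ x) = i) (hy : c (ρ y) = i),
        ((W.power r).induce {v | c v = i}).Reachable ⟨ρ x, hx⟩ ⟨ρ y, hy⟩
      iseqv :=
        { refl := fun x => ⟨_, rfl, rfl, .refl _⟩
          symm := by rintro x y ⟨i, hx, hy, h⟩; exact ⟨i, hy, hx, h.symm⟩
          trans := by
            rintro x y z ⟨i, hx, hy, h⟩ ⟨j, hy', hz, h'⟩
            obtain rfl : i = j := hy.symm.trans hy'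
            exact ⟨i, hx, hz, h.trans h'⟩ } }
  refine cayleyGraph_not_colourable n D (c ∘ ρ) s ?_ ?_
  · intro x y z hxz hyz hcol
    refine ⟨c (ρ y), hcol, rfl, ?_⟩
    -- Powers are loopless and `ρ` need not be injective.
    by_cases hne : ρ x = ρ y
    · rw [show (⟨ρ x, hcol⟩ : {v | c v = c (ρ y)}) = ⟨ρ y, rfl⟩ from Subtype.ext hne]
    · refine SimpleGraph.Adj.reachable (SimpleGraph.induce_adj.2 ?_)
      refine (SimpleGraph.fromRel_adj _ _ _).2 ⟨hne, Or.inl ?_⟩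
      refine (W.dist_triangle _ (ρ z) _).trans
        ((add_le_add (hadj x z hxz) (hadj z y hyz.symm)).trans ?_)
      rw [← ENNReal.ofReal_add hr' hr']
      exact ENNReal.ofReal_le_ofReal (by linarith)
  · rintro x y ⟨i, hx, hy, h⟩
    exact hdist x y (hc.dist_le h)

/-- If every graph is a minor of a graph in `𝒢`, then some graph in `𝒢` has edge lengths which
cannot be realised by a weighted graph with an `(n + 1)`-colouring whose components are bounded by
`D` on the appropriate scale. -/
theorem GraphClass.exists_lengths_not_isColouring (𝒢 : GraphClass)
    (h𝒢 : ∀ H : FinGraph, 𝒢.AdmitsMinor H) (n D : ℕ) :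
    ∃ G ∈ 𝒢.carrier, ∃ N : ℕ, 0 < N ∧ ∃ w : Sym2 G.V → ℕ, (∀ e, 0 < w e) ∧
      ∀ t : ℝ, 0 < t → ∀ (W : WeightedGraph) (ι : G.V → W.V),
        W.Realizes G (fun e => t * w e) ι → ∀ d : ℝ, d ≤ D * (N * t) →
        ∀ c : W.V → Fin (n + 1), ¬ W.IsColouring (6 * (N * t)) d c := by
  obtain ⟨G, hG, hm⟩ := h𝒢 ⟨_, inferInstance, cayleyGraph (n + 3) (D + 1)⟩
  obtain ⟨N, hN, w, hw, ρ, H⟩ := hm.exists_lengths D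
  refine ⟨G, hG, N, hN, w, hw, fun t ht W ι hW d hd c => ?_⟩
  obtain ⟨h1, h2⟩ := H t ht W ι hW
  have hNt : 0 < (N : ℝ) * t := by positivity
  refine W.not_isColouring n D (r' := 3 * N * t) (by positivity) (by linarith)
    (fun x => ι (ρ x)) h1 (fun u v huv => h2 u v (huv.trans_lt ?_)) c
  rw [ENNReal.ofReal_lt_ofReal_iff (by positivity)]
  linarith

theorem mainTheorem4 (𝒢 : GraphClass) (h𝒢 : ∀ H : FinGraph, 𝒢.AdmitsMinor H) :
    asdim (𝒢.weightsCompletion Set.univ) = ⊤ ∧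
    ANdim (𝒢.weightsCompletion posIntegers) = ⊤ ∧
    (𝒢.SubdivisionClosed → ANdim 𝒢.toWeighted = ⊤) := by
  refine ⟨iInf₂_eq_top.2 ?_, iInf₂_eq_top.2 ?_, fun hsub => iInf₂_eq_top.2 ?_⟩
  · rintro n ⟨f, hf⟩
    -- With `t = 1/N` the scale is 6 for every `G`, so `D` can be fixed before `G` and `N`.
    obtain ⟨D, hD⟩ := exists_nat_ge (f ⟨6, by norm_num⟩ : ℝ)
    obtain ⟨G, hG, N, hN, w, hw, H⟩ := 𝒢.exists_lengths_not_isColouring h𝒢 n D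
    have hN' : (0 : ℝ) < N := by exact_mod_cast hN
    have hℓ : ∀ e, 0 < (N : ℝ)⁻¹ * w e := fun e =>
      mul_pos (inv_pos.2 hN') (by exact_mod_cast hw e)
    obtain ⟨c, hc⟩ := hf (G.withLengths _ hℓ)
      ⟨hG, fun e => ⟨⟨_, hℓ e⟩, trivial, rfl⟩⟩ ⟨6, by norm_num⟩
    have hNN : (N : ℝ) * (N : ℝ)⁻¹ = 1 := mul_inv_cancel₀ hN'.ne'
    refine absurd hc ?_
    have := H _ (inv_pos.2 hN') _ _ (G.withLengths_realizes _ hℓ) (f ⟨6, by norm_num⟩)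
      (by rwa [hNN, mul_one]) c
    rwa [hNN, mul_one] at this
  · rintro n ⟨f, ⟨C, hC, hfC⟩, hf⟩
    -- Linearity gives `f (6N) ≤ 6CN ≤ DN`, with `D` independent of `N`.
    obtain ⟨D, hD⟩ := exists_nat_ge (6 * C)
    obtain ⟨G, hG, N, hN, w, hw, H⟩ := 𝒢.exists_lengths_not_isColouring h𝒢 n D
    have hN' : (0 : ℝ) < N := by exact_mod_cast hN
    have hℓ : ∀ e, 0 < (1 : ℝ) * w e := fun e => by
      rw [one_mul]; exact_mod_cast hw e
    let r : PosReal := ⟨6 * (N * 1), by positivity⟩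
    obtain ⟨c, hc⟩ := hf (G.withLengths _ hℓ)
      ⟨hG, fun e => ⟨⟨_, hℓ e⟩, ⟨w e, one_mul _⟩, rfl⟩⟩ r
    refine absurd hc (H 1 one_pos _ _ (G.withLengths_realizes _ hℓ) (f r) ?_ c)
    refine (hfC r).trans ?_
    calc C * (6 * (N * 1)) = (6 * C) * (N * 1) := by ring
      _ ≤ D * (N * 1) := by gcongr
  · rintro n ⟨f, ⟨C, hC, hfC⟩, hf⟩
    obtain ⟨D, hD⟩ := exists_nat_ge (6 * C)
    obtain ⟨G, hG, N, hN, w, hw, H⟩ := 𝒢.exists_lengths_not_isColouring h𝒢 n D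
    have hN' : (0 : ℝ) < N := by exact_mod_cast hN
    -- A path of length `w e ≥ 1` has `w e - 1` internal vertices.
    let k : G.graph.edgeSet → ℕ := fun e => w e - 1
    let r : PosReal := ⟨6 * (N * 1), by positivity⟩
    obtain ⟨c, hc⟩ := hf (G.subdivision k).toWeighted ⟨_, hsub G hG k, rfl⟩ r
    have hk : ∀ e : G.graph.edgeSet, (1 : ℝ) * w e = k e + 1 := fun e => by
      rw [one_mul]
      exact_mod_cast (Nat.sub_add_cancel (hw e)).symm
    refine absurd hc (H 1 one_pos _ _ (G.subdivision_realizes k (fun e => 1 * (w e : ℝ)) hk) (f r) ?_ c)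
    refine (hfC r).trans ?_
    calc C * (6 * (N * 1)) = (6 * C) * (N * 1) := by ring
      _ ≤ D * (N * 1) := by gcongr
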